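/- Let $\sigma$ be an $n$-simplex in a real affine space ($n\ge 0$), with affine hull $A$ and tangent space $T$ (the direction space of $A$). For integers $k,\ell\ge 0$ let $\mathrm{Alt}^{k,\ell}=\mathrm{Alt}^k(T)\otimes\mathrm{Alt}^\ell(T)$ be the space of alternating $k$-forms on $T$ with values in alternating $\ell$-forms on $T$. For $k\ge 1$ define $\mathcal S_\dagger^{k,\ell}:\mathrm{Alt}^{k,\ell}\to\mathrm{Alt}^{k-1,\ell+1}$ by $$\mathcal S_\dagger^{k,\ell}\omega(v_1,\dots,v_{k-1})(u_1,\dots,u_{\ell+1})=\sum_{j=1}^{\ell+1}(-1)^{j+1}\,\omega(u_j,v_1,\dots,v_{k-1})(u_1,\dots,\widehat{u_j},\dots,u_{\ell+1}),$$ and for $0\le p\le k$ let $\mathcal S_{\dagger,[p]}=\mathcal S_\dagger^{k-p+1,\ell+p-1}\circ\cdots\circ\mathcal S_\dagger^{k-1,\ell+1}\circ\mathcal S_\dagger^{k,\ell}:\mathrm{Alt}^{k,\ell}\to\mathrm{Alt}^{k-p,\ell+p}$ (so $\mathcal S_{\dagger,[1]}=\mathcal S_\dagger^{k,\ell}$,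 and $\mathcal S_{\dagger,[0]}$ is the identity); it acts pointwise on $\mathrm{Alt}^{k,\ell}$-valued functions. Fix a point $o\in A$ and let $\kappa$ be the Koszul operator in the first index, $(\kappa\omega)_x(v_1,\dots,v_k)=\omega_x(x-o,v_1,\dots,v_k)$. Let $$\mathcal P^-\mathrm{Alt}^{k,\ell}(\sigma)=\mathrm{Alt}^{k,\ell}+\kappa\,\mathrm{Alt}^{k+1,\ell}$$ be the sum of the constant $(k,\ell)$-forms and the images under $\kappa$ of the constant $(k+1,\ell)$-forms. Let $\mathcal B^-\mathrm{Alt}^{k,\ell}(\sigma)$ be the space of all $\omega\in\mathcal P^-\mathrm{Alt}^{k,\ell}(\sigma)$ such that, for every proper (nonempty) face $F$ of $\sigma$, the two-sided trace $\iota_F^*\iota_F^*\omega$ vanishes, that is, $\omega_x(v_1,\dots,v_k)(u_1,\dots,u_\ell)=0$ for all points $x$ of $F$ and all vectors $v_i,u_j$ tangent to $F$. Then, whenever $p\le k\le \ell+p-1$: 1. $\mathcal S_{\dagger,[p]}$ maps $\mathcal P^-\mathrm{Alt}^{k,\ell}(\sigma)$ onto $\mathcal P^-\mathrm{Alt}^{k-p,\ell+p}(\sigma)$;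 2. $\mathcal S_{\dagger,[p]}$ maps $\mathcal B^-\mathrm{Alt}^{k,\ell}(\sigma)$ onto $\mathcal B^-\mathrm{Alt}^{k-p,\ell+p}(\sigma)$. In particular ($p=1$), for $1\le k\le\ell$ the operator $\mathcal S_\dagger^{k,\ell}$ maps $\mathcal P^-\mathrm{Alt}^{k,\ell}(\sigma)$ onto $\mathcal P^-\mathrm{Alt}^{k-1,\ell+1}(\sigma)$ and $\mathcal B^-\mathrm{Alt}^{k,\ell}(\sigma)$ onto $\mathcal B^-\mathrm{Alt}^{k-1,\ell+1}(\sigma)$. -/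

import Mathlib

namespace FormForm

/-- `Alt T k l` is the space `Alt^{k,l}(T) = Alt^k(T) ⊗ Alt^l(T)` of alternating `k`-forms on `T`
with values in alternating `l`-forms on `T`; an element is evaluated as
`ω (v₁, …, v_k) (u₁, …, u_l)`. -/
abbrev Alt (T : Type*) [AddCommGroup T] [Module ℝ T] (k l : ℕ) : Type _ :=
  T [⋀^Fin k]→ₗ[ℝ] (T [⋀^Fin l]→ₗ[ℝ] ℝ)

section algebra

variable {T T' : Type*} [AddCommGroup T] [Module ℝ T] [AddCommGroup T'] [Module ℝ T']

/-- For fixed `v₁, …, v_k`, the linear map `u ↦ ω (u, v₁, …, v_k)`. -/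
def insertFirst {k l : ℕ} (ω : Alt T (k + 1) l) (v : Fin k → T) :
    T →ₗ[ℝ] (T [⋀^Fin l]→ₗ[ℝ] ℝ) where
  toFun u := ω.curryLeft u v
  map_add' a b := by simp only [map_add, AlternatingMap.add_apply]
  map_smul' c a := by simp only [map_smul, AlternatingMap.smul_apply, RingHom.id_apply]

/-- The operator `S_†^{k+1,l} : Alt^{k+1,l} → Alt^{k,l+1}`,
`(S_† ω) (v₁, …, v_k) (u₁, …, u_{l+1}) = ∑_j (-1)^{j+1} ω (u_j, v₁, …, v_k) (u₁, …, û_j, …, u_{l+1})`;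
see `sDaggerSucc_apply` (where `j` is counted from `0`). -/
noncomputable def sDaggerSucc (k l : ℕ) : Alt T (k + 1) l →ₗ[ℝ] Alt T k (l + 1) where
  toFun ω :=
    { toFun := fun v => AlternatingMap.alternatizeUncurryFin (insertFirst ω v)
      map_update_add' := by
        intro _ v i a b
        rw [← AlternatingMap.alternatizeUncurryFin_add]
        congr 1
        ext u : 1
        simp only [insertFirst, LinearMap.coe_mk, AddHom.coe_mk, LinearMap.add_apply]
        exact (ω.curryLeft u).map_update_add' v i a b
      map_update_smul' := by
        intro _ v i c a
        rw [← AlternatingMap.alternatizeUncurryFin_smul]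
        congr 1
        ext u : 1
        simp only [insertFirst, LinearMap.coe_mk, AddHom.coe_mk, LinearMap.smul_apply]
        exact (ω.curryLeft u).map_update_smul' v i c a
      map_eq_zero_of_eq' := by
        intro v i j h hij
        have h0 : insertFirst ω v = 0 := by
          ext u : 1
          exact (ω.curryLeft u).map_eq_zero_of_eq v h hij
        rw [h0]
        exact map_zero (AlternatingMap.alternatizeUncurryFinLM (R := ℝ) (M := T) (N := ℝ)) }
  map_add' ω η := by
    ext v : 1
    exact AlternatingMap.alternatizeUncurryFin_add (insertFirst ω v) (insertFirst η v)
  map_smul' c ω := by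
    ext v : 1
    exact AlternatingMap.alternatizeUncurryFin_smul c (insertFirst ω v)

theorem sDaggerSucc_apply (k l : ℕ) (ω : Alt T (k + 1) l) (v : Fin k → T) (u : Fin (l + 1) → T) :
    sDaggerSucc k l ω v u =
      ∑ j : Fin (l + 1), (-1 : ℝ) ^ (j : ℕ) * ω (Fin.cons (u j) v) (fun i => u (j.succAbove i)) := by
  change AlternatingMap.alternatizeUncurryFin (insertFirst ω v) u = _
  rw [AlternatingMap.alternatizeUncurryFin_apply]
  refine Finset.sum_congr rfl fun j _ => ?_
  rw [← Int.cast_smul_eq_zsmul ℝ, smul_eq_mul]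
  push_cast
  rfl

/-- The operator `S_†^{k,l} : Alt^{k,l} → Alt^{k-1,l+1}`. The target is only meaningful for
`1 ≤ k`; the value at `k = 0` is a placeholder. -/
noncomputable def sDagger : (k l : ℕ) → Alt T k l →ₗ[ℝ] Alt T (k - 1) (l + 1)
  | 0, _ => 0
  | k + 1, l => sDaggerSucc k l

/-- The iterated operator `S_{†,[p]}^{k,l} : Alt^{k,l} → Alt^{k-p,l+p}`, the composition
`S_†^{k-p+1,l+p-1} ∘ ⋯ ∘ S_†^{k-1,l+1} ∘ S_†^{k,l}`, meaningful for `p ≤ k`. -/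
noncomputable def sDaggerIter (k l : ℕ) : (p : ℕ) → Alt T k l →ₗ[ℝ] Alt T (k - p) (l + p)
  | 0 => LinearMap.id
  | p + 1 => (sDagger (k - p) (l + p)).comp (sDaggerIter k l p)

/-- The pullback of a form-valued form in both indices along a linear map `i`:
`(v₁, …, v_k) ↦ (u₁, …, u_l) ↦ ω (i v₁, …, i v_k) (i u₁, …, i u_l)`. -/
def pullback (i : T' →ₗ[ℝ] T) {k l : ℕ} (ω : Alt T k l) : Alt T' k l where
  toFun v := (ω (i ∘ v)).compLinearMap i
  map_update_add' := by
    intro _ v j a b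
    ext u
    exact congrArg (fun f => f (i ∘ u))
      ((ω.compLinearMap i).map_update_add' v j a b)
  map_update_smul' := by
    intro _ v j c a
    ext u
    exact congrArg (fun f => f (i ∘ u))
      ((ω.compLinearMap i).map_update_smul' v j c a)
  map_eq_zero_of_eq' := by
    intro v j j' h hj
    ext u
    exact congrArg (fun f => f (i ∘ u)) ((ω.compLinearMap i).map_eq_zero_of_eq v h hj)

end algebra

section simplex

variable {V P : Type*} [AddCommGroup V] [Module ℝ V] [AddTorsor V P]

/-- The affine hull of a simplex. -/
abbrev hull {n : ℕ} (σ : Affine.Simplex ℝ P n) : AffineSubspace ℝ P :=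
  affineSpan ℝ (Set.range σ.points)

/-- The tangent space of a simplex: the direction space of its affine hull. -/
abbrev Tangent {n : ℕ} (σ : Affine.Simplex ℝ P n) : Type _ := (hull σ).direction

/-- Fields of `(k,l)`-forms on a simplex `σ`. Only polynomial fields occur below; as a polynomial on
`σ` is the same thing as a polynomial on the affine hull of `σ`, the base points range over the
hull. -/
abbrev FormField {n : ℕ} (σ : Affine.Simplex ℝ P n) (k l : ℕ) : Type _ :=
  hull σ → Alt (Tangent σ) k l

variable {n : ℕ} (σ : Affine.Simplex ℝ P n)

/-- The Koszul operator in the first index, for the Euler vector field `x ↦ x - o`: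
`(κ ω)_x (v₁, …, v_k) = ω_x (x - o, v₁, …, v_k)`. -/
noncomputable def koszul (o : hull σ) (k l : ℕ) : FormField σ (k + 1) l →ₗ[ℝ] FormField σ k l where
  toFun ω x := (ω x).curryLeft (x -ᵥ o)
  map_add' _ _ := rfl
  map_smul' _ _ := rfl

/-- The constant fields of `(k,l)`-forms. -/
def constFields (k l : ℕ) : Submodule ℝ (FormField σ k l) :=
  LinearMap.range (LinearMap.pi fun _ : hull σ => (LinearMap.id : Alt (Tangent σ) k l →ₗ[ℝ] _))

/-- `P^- Alt^{k,l}(σ) = Alt^{k,l} + κ Alt^{k+1,l}`. -/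
noncomputable def PMinus (o : hull σ) (k l : ℕ) : Submodule ℝ (FormField σ k l) :=
  constFields σ k l ⊔ (constFields σ (k + 1) l).map (koszul σ o k l)

/-- The trace `ι_F^* ι_F^*` on the face `F` of `σ` whose `m + 1` vertices are indexed by `s`. -/
def trace {s : Finset (Fin (n + 1))} {m : ℕ} (h : s.card = m + 1) {k l : ℕ}
    (ω : FormField σ k l) : FormField (σ.face h) k l :=
  fun x => pullback (Submodule.inclusion (AffineSubspace.direction_le (σ.affineSpan_face_le h)))
    (ω ⟨x, σ.affineSpan_face_le h x.2⟩)

/-- The bubble space `B^- Alt^{k,l}(σ)`: the elements of `P^- Alt^{k,l}(σ)` whose trace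
`ι_F^* ι_F^*` vanishes on every proper face `F` of `σ`. -/
noncomputable def BMinus (o : hull σ) (k l : ℕ) : Submodule ℝ (FormField σ k l) where
  carrier := {ω | ω ∈ PMinus σ o k l ∧
    ∀ (s : Finset (Fin (n + 1))) (m : ℕ) (h : s.card = m + 1), s ≠ Finset.univ → trace σ h ω = 0}
  add_mem' := by
    rintro a b ⟨ha, ha'⟩ ⟨hb, hb'⟩
    refine ⟨add_mem ha hb, fun s m h hs => ?_⟩
    have : trace σ h (a + b) = trace σ h a + trace σ h b := by
      funext x
      ext v u
      rfl
    rw [this, ha' s m h hs, hb' s m h hs, add_zero]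
  zero_mem' := ⟨zero_mem _, fun s m h _ => by
    funext x
    ext v u
    rfl⟩
  smul_mem' := by
    rintro c a ⟨ha, ha'⟩
    refine ⟨Submodule.smul_mem _ c ha, fun s m h hs => ?_⟩
    have : trace σ h (c • a) = c • trace σ h a := by
      funext x
      ext v u
      rfl
    rw [this, ha' s m h hs, smul_zero]

/-- `S_{†,[p]}` acting pointwise on fields of form-valued forms. -/
noncomputable def sDaggerField (k l p : ℕ) : FormField σ k l →ₗ[ℝ] FormField σ (k - p) (l + p) :=
  (sDaggerIter k l p).compLeft (hull σ)

end simplex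

end FormForm

namespace FormForm

/-! In barycentric coordinates, every field in `P^- Alt^{k,l}(σ)` is a constant `(k+1,l)`-form on
`ℝ^{n+1}`, contracted in its first index with the position vector and restricted to tangent vectors
(`whitney`). `S_†` commutes with pullback and anticommutes with the contraction, so up to the sign
`(-1)^p` the problem is about `S_†^p` on constant forms, with first degree raised by one
(`sDaggerField_whitney`).

On constant forms, `S_†`, its transpose and multiplication by `k - l` satisfy the `sl₂` relations
(`lower_raise_add_weight`). The target bidegree `(k-p+1, l+p)` has weight `-M` with `M = l - k + 2p
- 1`, and the `p`-th power of the lowering operator reaches it when `p ≤ M`, which is `k + 1 ≤ l +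
p` (`exists_lower_pow_eq`).

For bubbles, the explicit right inverse `whitneyLift` of `whitney` turns vanishing traces into
vanishing pullbacks along all coordinate projections (`pullback_dropCoord_whitneyLift`), and
`trace_whitney` goes back. These projections are commuting idempotents whose pullbacks commute with
`S_†`, so a preimage can be corrected to vanish under all of them. -/

theorem cons_comp_succ_succAbove {X : Type*} {k : ℕ} (x : X) (v : Fin (k + 1) → X)
    (m : Fin (k + 1)) :
    (fun i => (Fin.cons x v : Fin (k + 2) → X) (m.succ.succAbove i)) =
      Fin.cons x (fun i => v (m.succAbove i)) := by
  funext i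
  refine Fin.cases ?_ (fun i => ?_) i <;> simp

/-! ### Strings of weight vectors in a representation of `sl₂` -/

section sl2

variable {W : Type*} [AddCommMonoid W] [Module ℝ W] {e f h : W →ₗ[ℝ] W}

theorem eq_sub_smul_of_add_smul_eq {x y : W} {a b : ℝ} (hx : x + b • y = a • y) :
    x = (a - b) • y := by
  rw [sub_eq_add_neg, add_smul, ← hx, add_assoc, ← add_smul, add_neg_cancel, zero_smul, add_zero]

theorem weight_raise_pow (hhe : ∀ x, h (e x) = e (h x) + (2 : ℝ) • e x) {z : W} {M : ℝ}
    (hz : h z = (-M) • z) (j : ℕ) : h ((e ^ j) z) = (2 * j - M) • (e ^ j) z := by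
  induction j with
  | zero => simp [hz]
  | succ j ih =>
    rw [pow_succ', Module.End.mul_apply, hhe, ih, map_smul, ← add_smul]
    congr 1
    push_cast
    ring

theorem weight_lower_pow (hhf : ∀ x, h (f x) + (2 : ℝ) • f x = f (h x)) {z : W} {M : ℝ}
    (hz : h z = (-M) • z) (j : ℕ) : h ((f ^ j) z) = (-(M + 2 * j)) • (f ^ j) z := by
  induction j with
  | zero => simp [hz]
  | succ j ih =>
    have := hhf ((f ^ j) z)
    rw [ih, map_smul] at this
    rw [pow_succ', Module.End.mul_apply, eq_sub_smul_of_add_smul_eq this]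
    congr 1
    push_cast
    ring

/-- The action of the lowering operator on the string generated by a lowest weight vector. -/
theorem lower_raise_pow_succ (hef : ∀ x, f (e x) + h x = e (f x))
    (hhe : ∀ x, h (e x) = e (h x) + (2 : ℝ) • e x) {z : W} {M : ℝ} (hz : h z = (-M) • z)
    (hfz : f z = 0) (j : ℕ) :
    f ((e ^ (j + 1)) z) = ((j + 1) * (M - j)) • (e ^ j) z := by
  -- Each raising step adds minus the current weight, `M - 2i`, to the coefficient; these add up to
  -- `(j + 1) (M - j)`.
  have key : ∀ (i : ℕ) (a : ℝ), e (f ((e ^ i) z)) = a • (e ^ i) z →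
      f ((e ^ (i + 1)) z) = (a - (2 * i - M)) • (e ^ i) z := by
    intro i a hi
    apply eq_sub_smul_of_add_smul_eq
    rw [pow_succ', Module.End.mul_apply, ← weight_raise_pow hhe hz, hef, hi]
  induction j with
  | zero =>
    rw [key 0 0 (by simp [hfz])]
    simp
  | succ j ih =>
    rw [key (j + 1) _ (by rw [ih, map_smul, ← Module.End.mul_apply, ← pow_succ'])]
    congr 1
    push_cast
    ring

/-- The constant is the product of the factors `(m + 1) (M - m)` over `i ≤ m < i + p`, all nonzero
because `m < M`. -/
theorem exists_lower_pow_raise_pow (hef : ∀ x, f (e x) + h x = e (f x))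
    (hhe : ∀ x, h (e x) = e (h x) + (2 : ℝ) • e x) {z : W} {M : ℝ} (hz : h z = (-M) • z)
    (hfz : f z = 0) (i p : ℕ) (hM : (i + p : ℝ) ≤ M) :
    ∃ c : ℝ, c ≠ 0 ∧ (f ^ p) ((e ^ (i + p)) z) = c • (e ^ i) z := by
  induction p with
  | zero => exact ⟨1, one_ne_zero, by simp⟩
  | succ p ih =>
    push_cast at hM
    obtain ⟨c, hc, h'⟩ := ih (by linarith)
    refine ⟨((i + p : ℕ) + 1) * (M - (i + p : ℕ)) * c, ?_, ?_⟩
    · refine mul_ne_zero (mul_ne_zero (by positivity) ?_) hc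
      push_cast
      linarith
    · rw [pow_succ, Module.End.mul_apply, ← add_assoc, lower_raise_pow_succ hef hhe hz hfz,
        map_smul, h', smul_smul]

/-- In a representation of `sl₂`, a vector of weight `-M` that is annihilated by a power of the
lowering operator `f` lies in the range of `f ^ p` for every `p ≤ M`. -/
theorem exists_lower_pow_eq (hef : ∀ x, f (e x) + h x = e (f x))
    (hhe : ∀ x, h (e x) = e (h x) + (2 : ℝ) • e x)
    (hhf : ∀ x, h (f x) + (2 : ℝ) • f x = f (h x)) {M : ℝ} {p : ℕ} (hp : (p : ℝ) ≤ M) (r : ℕ)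
    {y : W} (hy : h y = (-M) • y) (hr : (f ^ r) y = 0) : ∃ x, (f ^ p) x = y := by
  induction r generalizing y with
  | zero => exact ⟨0, by simpa using hr.symm⟩
  | succ r ih =>
    have hr0 : (0 : ℝ) ≤ r := by positivity
    have hp0 : (0 : ℝ) ≤ p := by positivity
    -- The vector `z = f ^ r y` is killed by `f` and has weight `-(M + 2r)`. Subtracting the right
    -- multiple of `e ^ r z` from `y` leaves a vector killed by `f ^ r`, and `e ^ r z` is itself a
    -- multiple of `f ^ p (e ^ (r + p) z)` because `r + p ≤ M + 2r`.
    have hz := weight_lower_pow hhf hy r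
    have hfz : f ((f ^ r) y) = 0 := by rw [← Module.End.mul_apply, ← pow_succ', hr]
    obtain ⟨c, hc, h1⟩ := exists_lower_pow_raise_pow hef hhe hz hfz 0 r
      (by push_cast; linarith)
    obtain ⟨c', hc', h2⟩ := exists_lower_pow_raise_pow hef hhe hz hfz r p (by linarith)
    rw [zero_add, pow_zero, Module.End.one_apply] at h1
    have hw : h ((e ^ r) ((f ^ r) y)) = (-M) • (e ^ r) ((f ^ r) y) := by
      rw [weight_raise_pow hhe hz]
      congr 1
      ring
    obtain ⟨x, hx⟩ := ih (y := y + (-c⁻¹) • (e ^ r) ((f ^ r) y))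
      (by rw [map_add, map_smul, hw, hy, smul_add, smul_comm])
      (by
        rw [map_add, map_smul, h1, smul_smul, neg_mul, inv_mul_cancel₀ hc]
        nth_rw 1 [← one_smul ℝ ((f ^ r) y)]
        rw [← add_smul, add_neg_cancel, zero_smul])
    refine ⟨x + (c⁻¹ * c'⁻¹) • (e ^ (r + p)) ((f ^ r) y), ?_⟩
    rw [map_add, hx, map_smul, h2, smul_smul, mul_assoc, inv_mul_cancel₀ hc', mul_one, add_assoc,
      ← add_smul, neg_add_cancel, zero_smul, add_zero]

end sl2

/-! ### The `sl₂` action on constant form-valued forms -/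

section graded

variable {T T' : Type*} [AddCommGroup T] [Module ℝ T] [AddCommGroup T'] [Module ℝ T']

theorem map_cons_cons_swap {N : Type*} [AddCommGroup N] [Module ℝ N] {k : ℕ}
    (ω : T [⋀^Fin (k + 2)]→ₗ[ℝ] N) (a b : T) (v : Fin k → T) :
    ω (Fin.cons a (Fin.cons b v)) = -ω (Fin.cons b (Fin.cons a v)) := by
  have h : (Fin.cons b (Fin.cons a v) : Fin (k + 2) → T) =
      (Fin.cons a (Fin.cons b v) : Fin (k + 2) → T) ∘ Equiv.swap (0 : Fin (k + 2)) 1 := by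
    funext i
    refine Fin.cases ?_ (fun i => Fin.cases ?_ (fun i => ?_) i) i
    · rw [Function.comp_apply, Equiv.swap_apply_left]
      rfl
    · rw [Function.comp_apply, Fin.succ_zero_eq_one, Equiv.swap_apply_right]
      rfl
    · rw [Function.comp_apply, Equiv.swap_apply_of_ne_of_ne (Fin.succ_ne_zero _)
        (by rw [← Fin.succ_zero_eq_one]; exact fun h => Fin.succ_ne_zero _ (Fin.succ_inj.1 h))]
      rfl
  rw [h, AlternatingMap.map_swap _ _ (by simp), neg_neg]

theorem map_cons_removeNth {N : Type*} [AddCommGroup N] [Module ℝ N] {k : ℕ}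
    (ω : T [⋀^Fin (k + 1)]→ₗ[ℝ] N) (v : Fin (k + 1) → T) (j : Fin (k + 1)) :
    ω (Fin.cons (v j) (fun i => v (j.succAbove i))) = (-1 : ℝ) ^ (j : ℕ) • ω v := by
  have := ω.neg_one_pow_smul_map_insertNth j (v j) (j.removeNth v)
  rw [Fin.insertNth_self_removeNth, ← Int.cast_smul_eq_zsmul ℝ] at this
  push_cast at this
  exact this.symm

theorem neg_one_pow_mul_self (j : ℕ) : (-1 : ℝ) ^ j * (-1 : ℝ) ^ j = 1 := by
  rw [← mul_pow]; simp

/-- Evaluation of alternating forms at a fixed tuple. -/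
def evalLinear {l : ℕ} (u : Fin l → T) : (T [⋀^Fin l]→ₗ[ℝ] ℝ) →ₗ[ℝ] ℝ where
  toFun a := a u
  map_add' _ _ := rfl
  map_smul' _ _ := rfl

/-- For a fixed `v`, the form `w ↦ u ↦ ω w (v, u)`, linear in `v`. -/
def insertSecond {k l : ℕ} (ω : Alt T k (l + 1)) : T →ₗ[ℝ] Alt T k l where
  toFun v := (AlternatingMap.curryLeftLinearMap.flip v).compAlternatingMap ω
  map_add' a b := by
    ext w u
    simp
  map_smul' c a := by
    ext w u
    simp

/-- The operator `Alt^{k,l+1} → Alt^{k+1,l}` transposed to `sDaggerSucc`. -/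
noncomputable def sSucc (k l : ℕ) : Alt T k (l + 1) →ₗ[ℝ] Alt T (k + 1) l where
  toFun ω := AlternatingMap.alternatizeUncurryFin (insertSecond ω)
  map_add' ω η := by
    rw [← AlternatingMap.alternatizeUncurryFin_add]
    rfl
  map_smul' c ω := by
    rw [RingHom.id_apply, ← AlternatingMap.alternatizeUncurryFin_smul]
    congr 1

theorem sSucc_apply (k l : ℕ) (ω : Alt T k (l + 1)) (v : Fin (k + 1) → T) (u : Fin l → T) :
    sSucc k l ω v u =
      ∑ j : Fin (k + 1), (-1 : ℝ) ^ (j : ℕ) * ω (fun i => v (j.succAbove i)) (Fin.cons (v j) u) := by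
  change AlternatingMap.alternatizeUncurryFin (insertSecond ω) v u = _
  rw [AlternatingMap.alternatizeUncurryFin_apply]
  refine (map_sum (evalLinear u) _ _).trans ?_
  refine Finset.sum_congr rfl fun j _ => ?_
  rw [← Int.cast_smul_eq_zsmul ℝ, map_smul, smul_eq_mul]
  push_cast
  rfl

/-- A vector moved from `u` to `v` and straight back reproduces `ω`, once for each of the `l + 1`
slots. The remaining terms exchange some `u j` with some `v m`; the opposite composition has the
same exchange terms, so they cancel in the commutator. -/
theorem sDaggerSucc_sSucc_apply (k l : ℕ) (ω : Alt T k (l + 1)) (v : Fin k → T)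
    (u : Fin (l + 1) → T) :
    sDaggerSucc k l (sSucc k l ω) v u = ((l : ℝ) + 1) * ω v u -
      ∑ j : Fin (l + 1), ∑ m : Fin k, (-1 : ℝ) ^ (j : ℕ) * (-1 : ℝ) ^ (m : ℕ) *
        ω (fun i => (Fin.cons (u j) v : Fin (k + 1) → T) (m.succ.succAbove i))
          (Fin.cons (v m) (fun i => u (j.succAbove i))) := by
  have h : ∀ j : Fin (l + 1), (-1 : ℝ) ^ (j : ℕ) *
      sSucc k l ω (Fin.cons (u j) v) (fun i => u (j.succAbove i)) = ω v u -
        ∑ m : Fin k, (-1 : ℝ) ^ (j : ℕ) * (-1 : ℝ) ^ (m : ℕ) *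
        ω (fun i => (Fin.cons (u j) v : Fin (k + 1) → T) (m.succ.succAbove i))
          (Fin.cons (v m) (fun i => u (j.succAbove i))) := by
    intro j
    rw [sSucc_apply, Fin.sum_univ_succ, mul_add, Finset.mul_sum, sub_eq_add_neg,
      ← Finset.sum_neg_distrib]
    congr 1
    · simp only [Fin.val_zero, pow_zero, one_mul, Fin.zero_succAbove, Fin.cons_succ, Fin.cons_zero]
      rw [map_cons_removeNth, smul_eq_mul, ← mul_assoc, neg_one_pow_mul_self, one_mul]
    · refine Finset.sum_congr rfl fun m _ => ?_
      rw [Fin.cons_succ, Fin.val_succ, pow_succ]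
      ring
  rw [sDaggerSucc_apply, Finset.sum_congr rfl fun j _ => h j, Finset.sum_sub_distrib]
  simp

theorem sSucc_sDaggerSucc_apply (k l : ℕ) (ω : Alt T (k + 1) l) (v : Fin (k + 1) → T)
    (u : Fin l → T) :
    sSucc k l (sDaggerSucc k l ω) v u = ((k : ℝ) + 1) * ω v u -
      ∑ m : Fin (k + 1), ∑ j : Fin l, (-1 : ℝ) ^ (m : ℕ) * (-1 : ℝ) ^ (j : ℕ) *
        ω (Fin.cons (u j) (fun i => v (m.succAbove i)))
          (fun i => (Fin.cons (v m) u : Fin (l + 1) → T) (j.succ.succAbove i)) := by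
  have h : ∀ m : Fin (k + 1), (-1 : ℝ) ^ (m : ℕ) *
      sDaggerSucc k l ω (fun i => v (m.succAbove i)) (Fin.cons (v m) u) = ω v u -
        ∑ j : Fin l, (-1 : ℝ) ^ (m : ℕ) * (-1 : ℝ) ^ (j : ℕ) *
        ω (Fin.cons (u j) (fun i => v (m.succAbove i)))
          (fun i => (Fin.cons (v m) u : Fin (l + 1) → T) (j.succ.succAbove i)) := by
    intro m
    rw [sDaggerSucc_apply, Fin.sum_univ_succ, mul_add, Finset.mul_sum, sub_eq_add_neg,
      ← Finset.sum_neg_distrib]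
    congr 1
    · simp only [Fin.val_zero, pow_zero, one_mul, Fin.zero_succAbove, Fin.cons_succ, Fin.cons_zero]
      rw [map_cons_removeNth, AlternatingMap.smul_apply, smul_eq_mul, ← mul_assoc,
        neg_one_pow_mul_self, one_mul]
    · refine Finset.sum_congr rfl fun j _ => ?_
      rw [Fin.cons_succ, Fin.val_succ, pow_succ]
      ring
  rw [sSucc_apply, Finset.sum_congr rfl fun j _ => h j, Finset.sum_sub_distrib]
  simp

/-- Families of `(k,l)`-forms, one for each bidegree. -/
abbrev Graded (T : Type*) [AddCommGroup T] [Module ℝ T] : Type _ := ∀ k l : ℕ, Alt T k l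

/-- `S_†` on families of forms. -/
noncomputable def lower : Graded T →ₗ[ℝ] Graded T where
  toFun g
    | _, 0 => 0
    | k, l + 1 => sDaggerSucc k l (g (k + 1) l)
  map_add' g g' := by
    funext k l
    cases l
    · exact (add_zero _).symm
    · exact map_add _ _ _
  map_smul' c g := by
    funext k l
    cases l
    · exact (smul_zero c).symm
    · exact (sDaggerSucc k _).map_smul c _

/-- The operator transposed to `S_†` on families of forms. -/
noncomputable def raise : Graded T →ₗ[ℝ] Graded T where
  toFun g
    | 0, _ => 0
    | k + 1, l => sSucc k l (g k (l + 1))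
  map_add' g g' := by
    funext k l
    cases k
    · exact (add_zero _).symm
    · exact map_add _ _ _
  map_smul' c g := by
    funext k l
    cases k
    · exact (smul_zero c).symm
    · exact (sSucc _ l).map_smul c _

/-- The operator multiplying `(k,l)`-forms by `k - l`. -/
noncomputable def weight : Graded T →ₗ[ℝ] Graded T where
  toFun g k l := ((k : ℝ) - l) • g k l
  map_add' g g' := by
    funext k l
    exact smul_add _ _ _
  map_smul' c g := by
    funext k l
    exact smul_comm _ c (g k l)

theorem lower_zero (g : Graded T) (k : ℕ) : lower g k 0 = 0 := rfl

theorem lower_succ (g : Graded T) (k l : ℕ) :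
    lower g k (l + 1) = sDaggerSucc k l (g (k + 1) l) := rfl

theorem raise_zero (g : Graded T) (l : ℕ) : raise g 0 l = 0 := rfl

theorem raise_succ (g : Graded T) (k l : ℕ) : raise g (k + 1) l = sSucc k l (g k (l + 1)) := rfl

theorem weight_apply (g : Graded T) (k l : ℕ) : weight g k l = ((k : ℝ) - l) • g k l := rfl

theorem weight_raise (g : Graded T) : weight (raise g) = raise (weight g) + (2 : ℝ) • raise g := by
  funext k l
  rw [Pi.add_apply, Pi.add_apply, Pi.smul_apply, Pi.smul_apply, weight_apply]
  cases k with
  | zero => simp [raise_zero]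
  | succ k =>
    rw [raise_succ, raise_succ, weight_apply, map_smul, ← add_smul]
    congr 1
    push_cast
    ring

theorem weight_lower (g : Graded T) : weight (lower g) + (2 : ℝ) • lower g = lower (weight g) := by
  funext k l
  rw [Pi.add_apply, Pi.add_apply, Pi.smul_apply, Pi.smul_apply, weight_apply]
  cases l with
  | zero => simp [lower_zero]
  | succ l =>
    rw [lower_succ, lower_succ, weight_apply, map_smul, ← add_smul]
    congr 1
    push_cast
    ring

theorem lower_raise_add_weight (g : Graded T) : lower (raise g) + weight g = raise (lower g) := by
  funext k l
  ext v u
  rw [Pi.add_apply, Pi.add_apply, weight_apply, AlternatingMap.add_apply,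
    AlternatingMap.add_apply, AlternatingMap.smul_apply, AlternatingMap.smul_apply, smul_eq_mul]
  rcases k with _ | k <;> rcases l with _ | l
  · simp [raise_zero, lower_zero]
  · rw [raise_zero, lower_succ, raise_succ, sDaggerSucc_sSucc_apply]
    simp
    ring
  · rw [lower_zero, raise_succ, lower_succ, sSucc_sDaggerSucc_apply]
    simp
  · rw [raise_succ, lower_succ, lower_succ, raise_succ, sSucc_sDaggerSucc_apply,
      sDaggerSucc_sSucc_apply, Finset.sum_comm]
    simp only [cons_comp_succ_succAbove, mul_comm ((-1 : ℝ) ^ (_ : ℕ)) ((-1 : ℝ) ^ (_ : ℕ))]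
    push_cast
    ring

/-- The entry comes from bidegree `(k + r, l - r)`: either that second degree is negative, or the
family vanishes in first degree `k + r`. -/
theorem lower_pow_eq_zero (g : Graded T) (r k l : ℕ) (h : l < r ∨ ∀ b, g (k + r) b = 0) :
    (lower ^ r) g k l = 0 := by
  induction r generalizing k l with
  | zero => exact (h.resolve_left (Nat.not_lt_zero _)) l
  | succ r ih =>
    rw [pow_succ', Module.End.mul_apply]
    cases l with
    | zero => rfl
    | succ l =>
      rw [lower_succ, ih, map_zero]
      exact h.imp (fun h => by omega) fun h b => by rw [add_right_comm]; exact h b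

/-- With `p ≤ k`, neither truncated subtraction nor the placeholder value of `sDagger` at first
degree `0` intervenes. -/
theorem lower_pow_apply (g : Graded T) (k l p : ℕ) (hp : p ≤ k) :
    (lower ^ p) g (k - p) (l + p) = sDaggerIter k l p (g k l) := by
  have hs : ∀ (g : Graded T) (a b : ℕ), 1 ≤ a → lower g (a - 1) (b + 1) = sDagger a b (g a b) := by
    intro g a b ha
    obtain ⟨a, rfl⟩ := Nat.exists_eq_add_of_le' ha
    rfl
  induction p with
  | zero => rfl
  | succ p ih =>
    rw [pow_succ', Module.End.mul_apply]
    refine (hs _ (k - p) (l + p) (by omega)).trans ?_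
    rw [ih (by omega)]
    rfl

/-- The family whose only nonzero member is `ω`, in bidegree `(k,l)`. -/
noncomputable def single (k l : ℕ) (ω : Alt T k l) : Graded T := Pi.single k (Pi.single l ω)

theorem single_same (k l : ℕ) (ω : Alt T k l) : single k l ω k l = ω := by
  simp [single]

theorem single_of_ne {k l : ℕ} (ω : Alt T k l) {a b : ℕ} (h : a ≠ k ∨ b ≠ l) :
    single k l ω a b = 0 := by
  by_cases ha : a = k
  · subst ha
    simp only [single, Pi.single_eq_same]
    exact Pi.single_eq_of_ne (h.resolve_left (not_not.2 rfl)) _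
  · rw [single, Pi.single_eq_of_ne ha]
    rfl

/-- On constant forms, the iterated operator `S_†` is onto in low first degree. -/
theorem exists_lower_pow_eq_single {k l p : ℕ} (h : k + p ≤ l) (ω : Alt T k l) :
    ∃ g : Graded T, (lower ^ p) g = single k l ω := by
  -- A form of bidegree `(k, l)` has weight `k - l = -M`, and `k + 1` applications of `S_†` exhaust
  -- its first degree.
  refine exists_lower_pow_eq lower_raise_add_weight weight_raise weight_lower
    (M := (l : ℝ) - k) ?_ (k + 1) ?_ ?_
  · have : ((k + p : ℕ) : ℝ) ≤ l := by exact_mod_cast h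
    push_cast at this
    linarith
  · funext a b
    rw [weight_apply, Pi.smul_apply, Pi.smul_apply]
    by_cases hab : a ≠ k ∨ b ≠ l
    · rw [single_of_ne _ hab, smul_zero, smul_zero]
    · push Not at hab
      obtain ⟨rfl, rfl⟩ := hab
      rw [neg_sub]
  · funext a b
    exact lower_pow_eq_zero _ _ _ _ (Or.inr fun b => single_of_ne _ (Or.inl (by omega)))

/-- The pullback in both indices on families of forms. -/
def pullbackGraded (i : T' →ₗ[ℝ] T) : Graded T →ₗ[ℝ] Graded T' where
  toFun g k l := pullback i (g k l)
  map_add' _ _ := rfl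
  map_smul' _ _ := rfl

theorem pullback_apply (i : T' →ₗ[ℝ] T) {k l : ℕ} (ω : Alt T k l) (v : Fin k → T')
    (u : Fin l → T') : pullback i ω v u = ω (fun a => i (v a)) (fun a => i (u a)) := rfl

theorem comp_cons (i : T' →ₗ[ℝ] T) {k : ℕ} (a : T') (v : Fin k → T') :
    (fun j => i ((Fin.cons a v : Fin (k + 1) → T') j)) = Fin.cons (i a) (fun j => i (v j)) := by
  funext j
  refine Fin.cases rfl (fun _ => rfl) j

theorem lower_pullbackGraded (i : T' →ₗ[ℝ] T) (g : Graded T) :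
    lower (pullbackGraded i g) = pullbackGraded i (lower g) := by
  funext k l
  cases l with
  | zero => rfl
  | succ l =>
    ext v u
    change sDaggerSucc k l (pullback i (g (k + 1) l)) v u =
      pullback i (sDaggerSucc k l (g (k + 1) l)) v u
    rw [pullback_apply, sDaggerSucc_apply, sDaggerSucc_apply]
    refine Finset.sum_congr rfl fun j _ => ?_
    rw [pullback_apply, comp_cons]

/-- The pullback along `i` of the contraction of the first index with `x`. -/
def contractGraded (i : T' →ₗ[ℝ] T) (x : T) : Graded T →ₗ[ℝ] Graded T' where
  toFun g k l := pullback i ((g (k + 1) l).curryLeft x)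
  map_add' _ _ := rfl
  map_smul' _ _ := rfl

/-- `S_†` inserts `u j` in front of the arguments, while contraction keeps `x` in front; exchanging
the two costs the sign. -/
theorem lower_contractGraded (i : T' →ₗ[ℝ] T) (x : T) (g : Graded T) :
    lower (contractGraded i x g) = (-1 : ℝ) • contractGraded i x (lower g) := by
  funext k l
  cases l with
  | zero => exact (smul_zero (-1 : ℝ)).symm
  | succ l =>
    ext v u
    change sDaggerSucc k l (pullback i ((g (k + 2) l).curryLeft x)) v u =
      (-1 : ℝ) * sDaggerSucc (k + 1) l (g (k + 2) l) (Fin.cons x fun a => i (v a)) fun a => i (u a)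
    rw [sDaggerSucc_apply, sDaggerSucc_apply, Finset.mul_sum]
    refine Finset.sum_congr rfl fun j _ => ?_
    rw [map_cons_cons_swap, pullback_apply, comp_cons, AlternatingMap.neg_apply, mul_neg, mul_neg,
      neg_one_mul, neg_neg]
    rfl

theorem lower_pow_contractGraded (i : T' →ₗ[ℝ] T) (x : T) (g : Graded T) (p : ℕ) :
    (lower ^ p) (contractGraded i x g) = (-1 : ℝ) ^ p • contractGraded i x ((lower ^ p) g) := by
  induction p with
  | zero => simp
  | succ p ih =>
    rw [pow_succ', Module.End.mul_apply, ih, map_smul, lower_contractGraded, pow_succ' lower,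
      Module.End.mul_apply, pow_succ, mul_smul]

end graded
end FormForm

namespace FormForm

/-! ### Whitney-type representation of `P^-` fields in barycentric coordinates -/

section barycentric

variable {T A : Type*} [AddCommGroup T] [Module ℝ T] [AddTorsor T A] {n : ℕ}
  (b : AffineBasis (Fin (n + 1)) ℝ A)

theorem sum_coords_smul_vsub (x o : A) : ∑ i, b.coords x i • (b i -ᵥ o) = x -ᵥ o := by
  have h := b.affineCombination_coord_eq_self x
  rw [Finset.affineCombination_eq_weightedVSubOfPoint_vadd_of_sum_eq_one _ _ _
    (b.sum_coord_apply_eq_one x) o, Finset.weightedVSubOfPoint_apply] at h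
  exact (eq_vadd_iff_vsub_eq _ _ _).1 h.symm |>.symm

theorem coords_linear_eq_sub (v : T) (o : A) :
    b.coords.linear v = b.coords (v +ᵥ o) - b.coords o := by
  rw [AffineMap.map_vadd, vadd_eq_add, add_sub_cancel_right]

theorem sum_coords_linear (v : T) : ∑ i, b.coords.linear v i = 0 := by
  simp only [coords_linear_eq_sub b v (b 0), Pi.sub_apply, Finset.sum_sub_distrib,
    AffineBasis.coords_apply, AffineBasis.sum_coord_apply_eq_one, sub_self]

theorem sum_coords_linear_smul_vsub (v : T) (o : A) :
    ∑ i, b.coords.linear v i • (b i -ᵥ o) = v := by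
  simp only [coords_linear_eq_sub b v o, Pi.sub_apply, sub_smul, Finset.sum_sub_distrib,
    sum_coords_smul_vsub, vsub_self, vadd_vsub, sub_zero]

theorem sum_coords_mul (x o : A) (C : ℝ) (G : T →ₗ[ℝ] ℝ) :
    ∑ i, b.coords x i * (C + G (b i -ᵥ o)) = C + G (x -ᵥ o) := by
  simp only [mul_add, Finset.sum_add_distrib, ← Finset.sum_mul, ← sum_coords_smul_vsub b x o,
    map_sum, map_smul, smul_eq_mul]
  simp

theorem sum_coords_linear_mul (v : T) (o : A) (C : ℝ) (G : T →ₗ[ℝ] ℝ) :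
    ∑ i, b.coords.linear v i * (C + G (b i -ᵥ o)) = G v := by
  conv_rhs => rw [← sum_coords_linear_smul_vsub b v o]
  simp only [mul_add, Finset.sum_add_distrib, ← Finset.sum_mul, sum_coords_linear, map_sum,
    map_smul, smul_eq_mul, zero_mul, zero_add]

/-- The field of `(k,l)`-forms obtained by contracting the first index of a constant
`(k + 1,l)`-form on the space of barycentric coordinates with the position vector, and
restricting to tangent vectors. -/
noncomputable def whitney {k l : ℕ} (η : Alt (Fin (n + 1) → ℝ) (k + 1) l) (x : A) : Alt T k l :=
  pullback b.coords.linear (η.curryLeft (b.coords x))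

theorem whitney_apply {k l : ℕ} (η : Alt (Fin (n + 1) → ℝ) (k + 1) l) (x : A) (v : Fin k → T)
    (u : Fin l → T) : whitney b η x v u =
      η (Fin.cons (b.coords x) fun a => b.coords.linear (v a)) fun a => b.coords.linear (u a) :=
  rfl

/-- Barycentric coordinates are affine in `x`, so the contraction splits into its value at `o` and a
Koszul term. -/
theorem whitney_eq_add {k l : ℕ} (η : Alt (Fin (n + 1) → ℝ) (k + 1) l) (o x : A) :
    whitney b η x = whitney b η o + (pullback b.coords.linear η).curryLeft (x -ᵥ o) := by
  have h : b.coords x = b.coords o + b.coords.linear (x -ᵥ o) := by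
    rw [AffineMap.linearMap_vsub, vsub_eq_sub, add_sub_cancel]
  ext v u
  rw [AlternatingMap.add_apply, AlternatingMap.add_apply, AlternatingMap.curryLeft_apply_apply,
    pullback_apply, Matrix.vecCons, comp_cons, whitney, h, map_add]
  rfl

/-- The linear extension to barycentric coordinates of `x ↦ x - b i`. -/
noncomputable def fromVertex (i : Fin (n + 1)) : (Fin (n + 1) → ℝ) →ₗ[ℝ] T :=
  Fintype.linearCombination ℝ fun j => b j -ᵥ b i

theorem fromVertex_apply (i : Fin (n + 1)) (c : Fin (n + 1) → ℝ) :
    fromVertex b i c = ∑ j, c j • (b j -ᵥ b i) := rfl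

theorem fromVertex_coords (i : Fin (n + 1)) (x : A) : fromVertex b i (b.coords x) = x -ᵥ b i :=
  sum_coords_smul_vsub b x (b i)

theorem fromVertex_coords_linear (i : Fin (n + 1)) (v : T) :
    fromVertex b i (b.coords.linear v) = v :=
  sum_coords_linear_smul_vsub b v (b i)

/-- A right inverse of `whitney` on fields of the form `a + κ β`. -/
noncomputable def whitneyLift {k l : ℕ} (ω : A → Alt T k l) : Alt (Fin (n + 1) → ℝ) (k + 1) l :=
  ((k : ℝ) + 1)⁻¹ • ∑ i, AlternatingMap.alternatizeUncurryFin
    ((LinearMap.proj i : (Fin (n + 1) → ℝ) →ₗ[ℝ] ℝ).smulRight (pullback (fromVertex b i) (ω (b i))))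

theorem whitneyLift_apply {k l : ℕ} (ω : A → Alt T k l) (w : Fin (k + 1) → Fin (n + 1) → ℝ)
    (u : Fin l → Fin (n + 1) → ℝ) : whitneyLift b ω w u =
      ((k : ℝ) + 1)⁻¹ * ∑ i, ∑ m : Fin (k + 1), (-1 : ℝ) ^ (m : ℕ) * (w m i *
        ω (b i) (fun a => fromVertex b i (w (m.succAbove a))) fun a => fromVertex b i (u a)) := by
  let ev : Alt (Fin (n + 1) → ℝ) (k + 1) l →ₗ[ℝ] ℝ :=
    { toFun := fun η => η w u
      map_add' := fun _ _ => rfl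
      map_smul' := fun _ _ => rfl }
  change ev (whitneyLift b ω) = _
  rw [whitneyLift, map_smul, map_sum, smul_eq_mul]
  congr 1
  refine Finset.sum_congr rfl fun i _ => ?_
  change evalLinear u (AlternatingMap.alternatizeUncurryFin _ w) = _
  rw [AlternatingMap.alternatizeUncurryFin_apply, map_sum]
  refine Finset.sum_congr rfl fun j _ => ?_
  rw [← Int.cast_smul_eq_zsmul ℝ, map_smul, smul_eq_mul]
  push_cast
  rfl

theorem sum_coords_mul_field {k l : ℕ} {ω : A → Alt T k l} {a : Alt T k l} {β : Alt T (k + 1) l}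
    {o : A} (hω : ∀ x, ω x = a + β.curryLeft (x -ᵥ o)) (x : A) (v : Fin k → T) (u : Fin l → T) :
    ∑ i, b.coords x i * ω (b i) v u = ω x v u := by
  simp only [hω]
  exact sum_coords_mul b x o (a v u) (evalLinear u ∘ₗ insertFirst β v)

/-- Although `ω` and `x - y` both depend on `y`, the map `y ↦ ω_y (x - y, v)` is affine: its
quadratic part is `β (y - o, y - o, v) = 0`. Weighting the vertex values by the derivatives of the
coordinates along `t` therefore returns its linear part at `t`. -/
theorem sum_coords_linear_mul_field {k l : ℕ} {ω : A → Alt T (k + 1) l} {a : Alt T (k + 1) l}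
    {β : Alt T (k + 2) l} {o : A} (hω : ∀ x, ω x = a + β.curryLeft (x -ᵥ o)) (x : A) (t : T)
    (v : Fin k → T) (u : Fin l → T) :
    ∑ i, b.coords.linear t i * ω (b i) (Fin.cons (x -ᵥ b i) v) u = -ω x (Fin.cons t v) u := by
  have hlin : ∀ y, a (Fin.cons (x -ᵥ y) v) u =
      a (Fin.cons (x -ᵥ o) v) u - (evalLinear u ∘ₗ insertFirst a v) (y -ᵥ o) := by
    intro y
    have := (evalLinear u ∘ₗ insertFirst a v).map_sub (x -ᵥ o) (y -ᵥ o)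
    rw [vsub_sub_vsub_cancel_right] at this
    exact this
  have hβ : ∀ y, β (Fin.cons (y -ᵥ o) (Fin.cons (x -ᵥ y) v)) u =
      (evalLinear u ∘ₗ insertFirst β (Fin.cons (x -ᵥ o) v)) (y -ᵥ o) := by
    intro y
    have h1 := (evalLinear u ∘ₗ insertFirst (β.curryLeft (y -ᵥ o)) v).map_sub (x -ᵥ o) (y -ᵥ o)
    rw [vsub_sub_vsub_cancel_right] at h1
    have h2 : β (Fin.cons (y -ᵥ o) (Fin.cons (y -ᵥ o) v)) = 0 :=
      β.map_eq_zero_of_eq _ (i := 0) (j := 1) rfl (by simp)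
    have h3 : (evalLinear u ∘ₗ insertFirst (β.curryLeft (y -ᵥ o)) v) (y -ᵥ o) = 0 :=
      congrArg (fun f : T [⋀^Fin l]→ₗ[ℝ] ℝ => f u) h2
    rw [h3, sub_zero] at h1
    exact h1
  have hterm : ∀ i, ω (b i) (Fin.cons (x -ᵥ b i) v) u = a (Fin.cons (x -ᵥ o) v) u +
      (evalLinear u ∘ₗ insertFirst β (Fin.cons (x -ᵥ o) v) - evalLinear u ∘ₗ insertFirst a v)
        (b i -ᵥ o) := by
    intro i
    rw [hω, LinearMap.sub_apply, ← hβ]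
    have := hlin (b i)
    change a (Fin.cons (x -ᵥ b i) v) u + β (Fin.cons (b i -ᵥ o) (Fin.cons (x -ᵥ b i) v)) u = _
    linarith
  rw [Finset.sum_congr rfl fun i _ => by rw [hterm i], sum_coords_linear_mul, hω]
  change β (Fin.cons t (Fin.cons (x -ᵥ o) v)) u - a (Fin.cons t v) u =
    -(a (Fin.cons t v) u + β (Fin.cons (x -ᵥ o) (Fin.cons t v)) u)
  rw [map_cons_cons_swap β t, AlternatingMap.neg_apply]
  ring

/-- Each of the `k + 1` terms of the alternatization equals `ω x`, whence the factor `(k + 1)⁻¹`.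
When the coordinate eats the position vector this is affine interpolation from the vertices; when it
eats a tangent vector, it is `sum_coords_linear_mul_field`. -/
theorem whitney_whitneyLift {k l : ℕ} {ω : A → Alt T k l} {a : Alt T k l} {β : Alt T (k + 1) l}
    {o : A} (hω : ∀ x, ω x = a + β.curryLeft (x -ᵥ o)) : whitney b (whitneyLift b ω) = ω := by
  funext x
  ext v u
  rw [whitney_apply, whitneyLift_apply, Finset.sum_comm, Fin.sum_univ_succ]
  have hk : (k : ℝ) + 1 ≠ 0 := by positivity
  rw [inv_mul_eq_iff_eq_mul₀ hk, add_mul, one_mul, add_comm]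
  congr 1
  · have hm : ∀ m : Fin k, ∑ i, (-1 : ℝ) ^ (m.succ : ℕ) *
        ((Fin.cons (b.coords x) fun a => b.coords.linear (v a) :
          Fin (k + 1) → Fin (n + 1) → ℝ) m.succ i *
        ω (b i) (fun a => fromVertex b i ((Fin.cons (b.coords x) fun a => b.coords.linear (v a) :
          Fin (k + 1) → Fin (n + 1) → ℝ) (m.succ.succAbove a)))
          fun a => fromVertex b i (b.coords.linear (u a))) = ω x v u := by
      intro m
      obtain ⟨k, rfl⟩ : ∃ k', k = k' + 1 := Nat.exists_eq_succ_of_ne_zero (by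
        rintro rfl
        exact m.elim0)
      have hc : ∀ i, (fun a => fromVertex b i ((Fin.cons (b.coords x) fun a => b.coords.linear (v a) :
          Fin (k + 2) → Fin (n + 1) → ℝ) (m.succ.succAbove a))) =
          Fin.cons (x -ᵥ b i) fun a => v (m.succAbove a) := by
        intro i
        have := cons_comp_succ_succAbove (b.coords x) (fun a => b.coords.linear (v a)) m
        funext a
        rw [congrFun this a]
        refine Fin.cases ?_ (fun a => ?_) a
        · exact fromVertex_coords b i x
        · exact fromVertex_coords_linear b i _
      simp only [hc, fromVertex_coords_linear, Fin.cons_succ, ← Finset.mul_sum]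
      rw [sum_coords_linear_mul_field b hω, map_cons_removeNth, AlternatingMap.smul_apply,
        smul_eq_mul, Fin.val_succ, pow_succ, mul_neg_one, neg_mul_neg, ← mul_assoc,
        neg_one_pow_mul_self, one_mul]
    rw [Finset.sum_congr rfl fun m _ => hm m]
    simp
  · simp only [Fin.val_zero, pow_zero, one_mul, Fin.zero_succAbove, Fin.cons_succ, Fin.cons_zero,
      fromVertex_coords_linear]
    exact sum_coords_mul_field b hω x v u

end barycentric

/-! ### Preimages killed by all coordinate projections -/

section annihilate

variable {n : ℕ}

/-- The projection setting the `j`-th coordinate to zero. -/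
noncomputable def dropCoord (j : Fin (n + 1)) : (Fin (n + 1) → ℝ) →ₗ[ℝ] (Fin (n + 1) → ℝ) :=
  LinearMap.pi fun i => if i = j then 0 else LinearMap.proj i

theorem dropCoord_apply_self (j : Fin (n + 1)) (c : Fin (n + 1) → ℝ) : dropCoord j c j = 0 := by
  simp [dropCoord]

theorem dropCoord_apply_of_ne {i j : Fin (n + 1)} (h : i ≠ j) (c : Fin (n + 1) → ℝ) :
    dropCoord j c i = c i := by
  simp [dropCoord, h]

theorem dropCoord_eq_self {j : Fin (n + 1)} {c : Fin (n + 1) → ℝ} (h : c j = 0) :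
    dropCoord j c = c := by
  funext i
  by_cases hi : i = j
  · rw [hi, dropCoord_apply_self, h]
  · rw [dropCoord_apply_of_ne hi]

theorem dropCoord_comm (i j : Fin (n + 1)) (c : Fin (n + 1) → ℝ) :
    dropCoord i (dropCoord j c) = dropCoord j (dropCoord i c) := by
  funext a
  simp only [dropCoord, LinearMap.pi_apply]
  split_ifs <;> simp [*]

theorem lower_pow_pullbackGraded {T T' : Type*} [AddCommGroup T] [Module ℝ T] [AddCommGroup T']
    [Module ℝ T'] (i : T' →ₗ[ℝ] T) (g : Graded T) (p : ℕ) :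
    (lower ^ p) (pullbackGraded i g) = pullbackGraded i ((lower ^ p) g) := by
  induction p with
  | zero => rfl
  | succ p ih =>
    rw [pow_succ', Module.End.mul_apply, ih, lower_pullbackGraded, pow_succ', Module.End.mul_apply]

/-- A preimage under a power of `S_†` can be chosen to be annihilated by the pullbacks along the
coordinate projections if this holds for the image. -/
theorem exists_lower_pow_eq_of_pullback_eq_zero {p : ℕ} {y : Graded (Fin (n + 1) → ℝ)}
    (hy : ∃ g, (lower ^ p) g = y) (hy0 : ∀ j, pullbackGraded (dropCoord j) y = 0) :
    ∃ g, (lower ^ p) g = y ∧ ∀ j, pullbackGraded (dropCoord j) g = 0 := by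
  suffices h : ∀ s : Finset (Fin (n + 1)), ∃ g, (lower ^ p) g = y ∧
      ∀ j ∈ s, pullbackGraded (dropCoord j) g = 0 by
    obtain ⟨g, hg, hg0⟩ := h Finset.univ
    exact ⟨g, hg, fun j => hg0 j (Finset.mem_univ j)⟩
  have hcomm : ∀ (i j : Fin (n + 1)) (g : Graded (Fin (n + 1) → ℝ)),
      pullbackGraded (dropCoord i) (pullbackGraded (dropCoord j) g) =
        pullbackGraded (dropCoord j) (pullbackGraded (dropCoord i) g) := by
    intro i j g
    funext k l
    ext v u
    change g k l (fun a => dropCoord j (dropCoord i (v a))) (fun a => dropCoord j (dropCoord i (u a)))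
      = g k l (fun a => dropCoord i (dropCoord j (v a))) (fun a => dropCoord i (dropCoord j (u a)))
    simp only [dropCoord_comm i j]
  have hidem : ∀ (j : Fin (n + 1)) (g : Graded (Fin (n + 1) → ℝ)),
      pullbackGraded (dropCoord j) (pullbackGraded (dropCoord j) g) =
        pullbackGraded (dropCoord j) g := by
    intro j g
    funext k l
    ext v u
    change g k l (fun a => dropCoord j (dropCoord j (v a))) (fun a => dropCoord j (dropCoord j (u a)))
      = g k l (fun a => dropCoord j (v a)) (fun a => dropCoord j (u a))
    simp only [dropCoord_eq_self (dropCoord_apply_self _ _)]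
  intro s
  induction s using Finset.induction_on with
  | empty =>
    obtain ⟨g, hg⟩ := hy
    exact ⟨g, hg, by simp⟩
  | insert i s _ ih =>
    obtain ⟨g, hg, hg0⟩ := ih
    -- Apply the complementary idempotent: the image is unchanged since the pullback of `y`
    -- vanishes, and commutation preserves the earlier vanishing conditions.
    refine ⟨g + (-1 : ℝ) • pullbackGraded (dropCoord i) g, ?_, fun j hj => ?_⟩
    · rw [map_add, map_smul, lower_pow_pullbackGraded, hg, hy0, smul_zero, add_zero]
    · rw [map_add, map_smul]
      rcases Finset.mem_insert.1 hj with rfl | hj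
      · rw [hidem]
        nth_rw 1 [← one_smul ℝ (pullbackGraded (dropCoord j) g)]
        rw [← add_smul, add_neg_cancel, zero_smul]
      · rw [hcomm, hg0 j hj, map_zero, smul_zero, add_zero]

end annihilate

end FormForm

namespace FormForm

/-! ### Faces, traces and bubbles -/

section simplex

variable {V P : Type*} [AddCommGroup V] [Module ℝ V] [AddTorsor V P] {n : ℕ}
  (σ : Affine.Simplex ℝ P n)

/-- The vertices of a simplex as an affine basis of its affine hull. -/
noncomputable def vertexBasis : AffineBasis (Fin (n + 1)) ℝ (hull σ) where
  toFun i := ⟨σ.points i, mem_affineSpan ℝ (Set.mem_range_self i)⟩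
  ind' := AffineIndependent.of_comp (hull σ).subtype σ.independent
  tot' := by
    rw [← affineSpan_coe_preimage_eq_top (k := ℝ) (Set.range σ.points)]
    congr 1
    ext x
    simp only [Set.mem_range, Set.mem_preimage, Subtype.ext_iff]

theorem mem_PMinus_iff (o : hull σ) {k l : ℕ} (ω : FormField σ k l) :
    ω ∈ PMinus σ o k l ↔ ∃ (a : Alt (Tangent σ) k l) (β : Alt (Tangent σ) (k + 1) l),
      ∀ x, ω x = a + β.curryLeft (x -ᵥ o) := by
  rw [PMinus, Submodule.mem_sup]
  constructor
  · rintro ⟨_, ⟨a, rfl⟩, _, ⟨_, ⟨β, rfl⟩, rfl⟩, rfl⟩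
    exact ⟨a, β, fun x => rfl⟩
  · rintro ⟨a, β, h⟩
    exact ⟨_, ⟨a, rfl⟩, _, ⟨_, ⟨β, rfl⟩, rfl⟩, funext fun x => (h x).symm⟩

theorem whitney_mem_PMinus (o : hull σ) {k l : ℕ} (η : Alt (Fin (n + 1) → ℝ) (k + 1) l) :
    whitney (vertexBasis σ) η ∈ PMinus σ o k l :=
  (mem_PMinus_iff σ o _).2 ⟨_, _, whitney_eq_add (vertexBasis σ) η o⟩

theorem whitney_whitneyLift_of_mem {o : hull σ} {k l : ℕ} {ω : FormField σ k l}
    (hω : ω ∈ PMinus σ o k l) :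
    whitney (vertexBasis σ) (whitneyLift (vertexBasis σ) ω) = ω := by
  obtain ⟨a, β, h⟩ := (mem_PMinus_iff σ o ω).1 hω
  exact whitney_whitneyLift _ h

/-- The coordinate is affine and vanishes at every vertex of the face. -/
theorem coord_comp_inclusion_face {s : Finset (Fin (n + 1))} {m : ℕ} (h : s.card = m + 1)
    {j : Fin (n + 1)} (hj : j ∉ s) :
    ((vertexBasis σ).coord j).comp (AffineSubspace.inclusion (σ.affineSpan_face_le h)) = 0 := by
  refine AffineMap.ext_on (vertexBasis (σ.face h)).tot ?_
  rintro _ ⟨i, rfl⟩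
  have hi : AffineSubspace.inclusion (σ.affineSpan_face_le h) (vertexBasis (σ.face h) i) =
      vertexBasis σ (s.orderEmbOfFin h i) := rfl
  rw [AffineMap.comp_apply, hi, AffineBasis.coord_apply_ne]
  · rfl
  · rintro rfl
    exact hj (s.orderEmbOfFin_mem h i)

theorem coords_face {s : Finset (Fin (n + 1))} {m : ℕ} (h : s.card = m + 1) {j : Fin (n + 1)}
    (hj : j ∉ s) (x : hull (σ.face h)) :
    (vertexBasis σ).coords ⟨x, σ.affineSpan_face_le h x.2⟩ j = 0 :=
  DFunLike.congr_fun (coord_comp_inclusion_face σ h hj) x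

theorem coords_linear_face {s : Finset (Fin (n + 1))} {m : ℕ} (h : s.card = m + 1)
    {j : Fin (n + 1)} (hj : j ∉ s) (t : Tangent (σ.face h)) :
    (vertexBasis σ).coords.linear
      (Submodule.inclusion (AffineSubspace.direction_le (σ.affineSpan_face_le h)) t) j = 0 :=
  DFunLike.congr_fun (congrArg AffineMap.linear (coord_comp_inclusion_face σ h hj)) t

/-- Points and tangent vectors of a face missing the vertex `j` have zero `j`-th coordinate, so
`dropCoord j` fixes every argument of `η`. -/
theorem trace_whitney {s : Finset (Fin (n + 1))} {m : ℕ} (h : s.card = m + 1) {j : Fin (n + 1)}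
    (hj : j ∉ s) {k l : ℕ} {η : Alt (Fin (n + 1) → ℝ) (k + 1) l}
    (hη : pullback (dropCoord j) η = 0) : trace σ h (whitney (vertexBasis σ) η) = 0 := by
  funext x
  ext v u
  let i := Submodule.inclusion (AffineSubspace.direction_le (σ.affineSpan_face_le h))
  let x' : hull σ := ⟨x, σ.affineSpan_face_le h x.2⟩
  have hη' : pullback (dropCoord j) η
      (Fin.cons ((vertexBasis σ).coords x') fun a => (vertexBasis σ).coords.linear (i (v a)))
      (fun a => (vertexBasis σ).coords.linear (i (u a))) = 0 := by
    rw [hη]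
    rfl
  rw [pullback_apply, comp_cons, dropCoord_eq_self (coords_face σ h hj x)] at hη'
  simp only [i, dropCoord_eq_self (coords_linear_face σ h hj _)] at hη'
  exact hη'

theorem fromVertex_mem_face {s : Finset (Fin (n + 1))} {m : ℕ} (h : s.card = m + 1)
    {i : Fin (n + 1)} (hi : i ∈ s) {c : Fin (n + 1) → ℝ} (hc : ∀ j ∉ s, c j = 0) :
    (fromVertex (vertexBasis σ) i c : V) ∈ (hull (σ.face h)).direction := by
  have hmem : ∀ j ∈ s, σ.points j ∈ hull (σ.face h) := fun j hj =>
    mem_affineSpan ℝ (by rw [Affine.Simplex.range_face_points]; exact Set.mem_image_of_mem _ hj)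
  rw [fromVertex_apply, Submodule.coe_sum]
  refine Submodule.sum_mem _ fun j _ => ?_
  by_cases hj : j ∈ s
  · exact Submodule.smul_mem _ _ (AffineSubspace.vsub_mem_direction (hmem j hj) (hmem i hi))
  · rw [hc j hj, zero_smul]
    exact Submodule.zero_mem _

/-- After dropping coordinate `j`, the term of vertex `j` loses its coordinate factor. For `i ≠ j`,
`fromVertex` sends the arguments to vectors tangent to the face opposite `j`; that face contains
vertex `i`, so the trace of `ω` there vanishes. Basing the lift at the vertices is what makes this
work. -/
theorem pullback_dropCoord_whitneyLift {o : hull σ} {k l : ℕ} {ω : FormField σ k l}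
    (hω : ω ∈ BMinus σ o k l) (j : Fin (n + 1)) :
    pullback (dropCoord j) (whitneyLift (vertexBasis σ) ω) = 0 := by
  ext w u
  rw [pullback_apply, whitneyLift_apply]
  refine mul_eq_zero_of_right _ (Finset.sum_eq_zero fun i _ => Finset.sum_eq_zero fun a _ =>
    mul_eq_zero_of_right _ ?_)
  by_cases hij : i = j
  · rw [hij, dropCoord_apply_self, zero_mul]
  · refine mul_eq_zero_of_right _ ?_
    have hi : i ∈ Finset.univ.erase j := Finset.mem_erase.2 ⟨hij, Finset.mem_univ i⟩
    obtain ⟨m, h⟩ := Nat.exists_eq_succ_of_ne_zero (Finset.card_pos.2 ⟨i, hi⟩).ne'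
    have hmem : ∀ c, (fromVertex (vertexBasis σ) i (dropCoord j c) : V) ∈
        (hull (σ.face h)).direction := fun c => fromVertex_mem_face σ h hi fun j' hj' => by
      obtain rfl : j' = j := by simpa using hj'
      exact dropCoord_apply_self _ _
    have ht := hω.2 _ m h fun hs => Finset.notMem_erase j _ (hs ▸ Finset.mem_univ j)
    have hp : σ.points i ∈ hull (σ.face h) :=
      mem_affineSpan ℝ (by rw [Affine.Simplex.range_face_points]; exact Set.mem_image_of_mem _ hi)
    exact congrArg (fun f : Alt (Tangent (σ.face h)) k l =>
      f (fun b => ⟨_, hmem (w (a.succAbove b))⟩) fun b => ⟨_, hmem (u b)⟩) (congrFun ht ⟨_, hp⟩)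

theorem sDaggerField_whitney {k l p : ℕ} (hp : p ≤ k) (g : Graded (Fin (n + 1) → ℝ)) :
    sDaggerField σ k l p (whitney (vertexBasis σ) (g (k + 1) l)) =
      whitney (vertexBasis σ) ((-1 : ℝ) ^ p • (lower ^ p) g (k - p + 1) (l + p)) := by
  funext x
  change sDaggerIter k l p (contractGraded (vertexBasis σ).coords.linear
    ((vertexBasis σ).coords x) g k l) = _
  rw [← lower_pow_apply _ _ _ _ hp, lower_pow_contractGraded]
  rfl

end simplex

end FormForm

/-! ### Surjectivity on `P^-` and on bubbles -/

theorem mainTheorem2 {V P : Type*} [AddCommGroup V] [Module ℝ V] [AddTorsor V P]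
    {n : ℕ} (σ : Affine.Simplex ℝ P n)
    (o : FormForm.hull σ) (k l p : ℕ) (hpk : p ≤ k) (hk : k + 1 ≤ l + p) :
    (FormForm.PMinus σ o k l).map (FormForm.sDaggerField σ k l p)
        = FormForm.PMinus σ o (k - p) (l + p) ∧
      (FormForm.BMinus σ o k l).map (FormForm.sDaggerField σ k l p)
        = FormForm.BMinus σ o (k - p) (l + p) := by
  open FormForm in
  have hsq : (-1 : ℝ) ^ p * (-1 : ℝ) ^ p = 1 := neg_one_pow_mul_self p
  have hsurj : ∀ η : Alt (Fin (n + 1) → ℝ) (k - p + 1) (l + p),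
      ∃ g, (lower ^ p) g = single (k - p + 1) (l + p) η :=
    -- The bound needed is `(k - p + 1) + p ≤ l + p`, which is exactly `hk`.
    exists_lower_pow_eq_single (by omega)
  have hpreimage : ∀ (ω : FormField σ (k - p) (l + p)) (g : Graded (Fin (n + 1) → ℝ)),
      ω ∈ PMinus σ o (k - p) (l + p) →
      (lower ^ p) g = single (k - p + 1) (l + p) (whitneyLift (vertexBasis σ) ω) →
      -- The factor `(-1) ^ p` cancels the sign from moving `S_†` past the contraction `p` times.
      sDaggerField σ k l p (whitney (vertexBasis σ) (((-1 : ℝ) ^ p • g) (k + 1) l)) = ω := by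
    intro ω g hω hg
    rw [sDaggerField_whitney σ hpk, map_smul, hg, Pi.smul_apply, Pi.smul_apply, single_same,
      smul_smul, hsq, one_smul, whitney_whitneyLift_of_mem σ hω]
  have himage : ∀ ω ∈ PMinus σ o k l, sDaggerField σ k l p ω = whitney (vertexBasis σ)
      ((-1 : ℝ) ^ p • (lower ^ p) (single (k + 1) l (whitneyLift (vertexBasis σ) ω))
        (k - p + 1) (l + p)) := by
    intro ω hω
    rw [← sDaggerField_whitney σ hpk, single_same, whitney_whitneyLift_of_mem σ hω]
  constructor
  · apply le_antisymm
    · rintro _ ⟨ω, hω, rfl⟩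
      rw [himage ω hω]
      exact whitney_mem_PMinus σ o _
    · intro ω hω
      obtain ⟨g, hg⟩ := hsurj (whitneyLift (vertexBasis σ) ω)
      exact ⟨_, whitney_mem_PMinus σ o _, hpreimage ω g hω hg⟩
  · have hsingle : ∀ {a b : ℕ} {ω : FormField σ a b}, ω ∈ BMinus σ o a b → ∀ j,
        pullbackGraded (dropCoord j) (single (a + 1) b (whitneyLift (vertexBasis σ) ω)) = 0 := by
      intro a b ω hω j
      funext a' b'
      by_cases hab : a' ≠ a + 1 ∨ b' ≠ b
      · change pullback _ (single _ _ _ a' b') = 0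
        rw [single_of_ne _ hab]
        rfl
      · push Not at hab
        obtain ⟨rfl, rfl⟩ := hab
        change pullback _ (single _ _ _ _ _) = 0
        rw [single_same]
        exact pullback_dropCoord_whitneyLift σ hω j
    have hmem : ∀ {a b : ℕ} {η : Alt (Fin (n + 1) → ℝ) (a + 1) b},
        (∀ j, pullback (dropCoord j) η = 0) → whitney (vertexBasis σ) η ∈ BMinus σ o a b := by
      intro a b η hη
      refine ⟨whitney_mem_PMinus σ o η, fun s m h hs => ?_⟩
      obtain ⟨j, hj⟩ : ∃ j, j ∉ s := by
        by_contra! hall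
        exact hs (Finset.eq_univ_iff_forall.2 hall)
      exact trace_whitney σ h hj (hη j)
    have hgraded : ∀ {g : Graded (Fin (n + 1) → ℝ)}, (∀ j, pullbackGraded (dropCoord j) g = 0) →
        ∀ (c : ℝ) (a b : ℕ) (j), pullback (dropCoord j) (c • g a b) = 0 := by
      intro g hg c a b j
      have := congrFun (congrFun ((pullbackGraded (dropCoord j)).map_smul c g) a) b
      rw [hg, smul_zero] at this
      exact this
    apply le_antisymm
    · rintro _ ⟨ω, hω, rfl⟩
      rw [himage ω hω.1]
      refine hmem (hgraded (fun j => ?_) _ _ _)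
      rw [← lower_pow_pullbackGraded, hsingle hω, map_zero]
    · intro ω hω
      -- The lift of a bubble is killed by every coordinate projection, so its preimage can be
      -- chosen with the same property and again yields a bubble.
      obtain ⟨g, hg, hg0⟩ := exists_lower_pow_eq_of_pullback_eq_zero
        (hsurj (whitneyLift (vertexBasis σ) ω)) (hsingle hω)
      exact ⟨_, hmem (hgraded hg0 _ _ _), hpreimage ω g hω.1 hg⟩
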